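/- Fix $n\ge 1$ actions, $m$ outcomes and a reward vector $r\in[0,1]^m$. An agent type is a pair $\theta=(f,c)$, where $f=(f_1,\dots,f_n)$, each $f_i=(f_{i,1},\dots,f_{i,m})$ is a probability distribution on the $m$ outcomes, and $c\in[0,\infty)^n$ is a cost vector with $c_1=0$. Under a contract (payment vector) $t\in\mathbb{R}^m$, the agent of type $\theta$ chooses an action $i^*(\theta,t)$ that maximizes her expected utility $\sum_{j=1}^m f_{i,j}t_j-c_i$ over $i\in\{1,\dots,n\}$, with ties broken in favor of the principal, that is, $i^*(\theta,t)$ maximizes $\sum_{j=1}^m f_{i,j}(r_j-t_j)$ among all maximizers $i$ of the agent's utility. The principal's utility is $u_p(\theta,t)=\sum_{j=1}^m f_{i^*(\theta,t),j}(r_j-t_j)$. For a probability distribution $\mathcal D$ on types write $U_p(\mathcal D,t)=\mathbb{E}_{\theta\sim\mathcal D}[u_p(\theta,t)]$, and for a sample $S=(\theta_1,\dots,\theta_s)$ of types write $U_p(S,t)=\frac1s\sum_{k=1}^s u_p(\theta_k,t)$. For $\alpha\in[0,1]$ write $U_p(\cdot,\alpha)$ for $U_p(\cdot,\alpha r)$,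 the utility under the linear contract $\alpha r$. **Theorem (uniform convergence for linear contracts).** Let $\mathcal D$ be any probability distribution on agent types, let $\varepsilon>0$ and $\delta\in(0,1)$, and let $s$ be an integer with $s\ge 3456\ln(4/\delta)/\varepsilon^2$. Then, with probability at least $1-\delta$ over an i.i.d. sample $S\sim\mathcal D^s$, it holds simultaneously for all $\alpha\in[0,1]$ that $$|U_p(\mathcal D,\alpha)-U_p(S,\alpha)|\le\varepsilon .$$ In particular, the required number of samples does not depend on the number of actions $n$ or the number of outcomes $m$. -/

import Mathlib

open MeasureTheory

namespace Contracts

/-- A private agent type `θ = (f, c)` with `n` actions and `m` outcomes: `f i j` is the probability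
of outcome `j` under action `i`, and `c i` is the agent's cost of action `i`. The first action is an
outside option of zero cost. -/
structure AgentType (n m : ℕ) [NeZero n] where
  f : Fin n → Fin m → ℝ
  c : Fin n → ℝ
  f_mem : ∀ i, f i ∈ stdSimplex ℝ (Fin m)
  c_nonneg : ∀ i, 0 ≤ c i
  c_zero : c 0 = 0

variable {n m : ℕ} [NeZero n]

/-- The Borel structure of the type space as a subset of `ℝ^(n × m) × ℝ^n`. -/
instance : MeasurableSpace (AgentType n m) :=
  MeasurableSpace.comap (fun θ => (θ.f, θ.c)) inferInstance

/-- The agent's expected utility for action `i` under the contract (payment vector) `t`. -/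
def agentUtility (θ : AgentType n m) (t : Fin m → ℝ) (i : Fin n) : ℝ :=
  ∑ j, θ.f i j * t j - θ.c i

/-- The principal's expected utility under the contract `t`, for rewards `r`, if the agent takes
action `i`. -/
def actionValue (r : Fin m → ℝ) (θ : AgentType n m) (t : Fin m → ℝ) (i : Fin n) : ℝ :=
  ∑ j, θ.f i j * (r j - t j)

/-- Action `i` maximizes the agent's expected utility under `t`. -/
def IsBestAction (θ : AgentType n m) (t : Fin m → ℝ) (i : Fin n) : Prop :=
  ∀ k, agentUtility θ t k ≤ agentUtility θ t i

/-- Action `i` is one of the agent's best actions, and among these it is best for the principal. -/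
def IsFavoredAction (r : Fin m → ℝ) (θ : AgentType n m) (t : Fin m → ℝ) (i : Fin n) : Prop :=
  IsBestAction θ t i ∧ ∀ k, IsBestAction θ t k → actionValue r θ t k ≤ actionValue r θ t i

theorem exists_isFavoredAction (r : Fin m → ℝ) (θ : AgentType n m) (t : Fin m → ℝ) :
    ∃ i, IsFavoredAction r θ t i := by
  classical
  obtain ⟨i₀, -, h₀⟩ := Finset.exists_max_image Finset.univ (agentUtility θ t)
    ⟨(0 : Fin n), Finset.mem_univ _⟩
  obtain ⟨i, hi, hmax⟩ := Finset.exists_max_image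
    (Finset.univ.filter fun i => IsBestAction θ t i) (actionValue r θ t)
    ⟨i₀, Finset.mem_filter.2 ⟨Finset.mem_univ _, fun k => h₀ k (Finset.mem_univ k)⟩⟩
  exact ⟨i, (Finset.mem_filter.1 hi).2, fun k hk =>
    hmax k (Finset.mem_filter.2 ⟨Finset.mem_univ _, hk⟩)⟩

/-- The action `i*(θ, t)` that the agent chooses: a best action, ties broken in the principal's
favor. -/
noncomputable def chosenAction (r : Fin m → ℝ) (θ : AgentType n m) (t : Fin m → ℝ) : Fin n :=
  Classical.choose (exists_isFavoredAction r θ t)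

theorem chosenAction_spec (r : Fin m → ℝ) (θ : AgentType n m) (t : Fin m → ℝ) :
    IsFavoredAction r θ t (chosenAction r θ t) :=
  Classical.choose_spec (exists_isFavoredAction r θ t)

/-- The principal's utility `u_p(θ, t)`. -/
noncomputable def principalUtility (r : Fin m → ℝ) (θ : AgentType n m) (t : Fin m → ℝ) : ℝ :=
  actionValue r θ t (chosenAction r θ t)

/-- The expected utility `U_p(D, t)` of the principal over the type distribution `D`. -/
noncomputable def expectedUtility (r : Fin m → ℝ) (D : Measure (AgentType n m))
    (t : Fin m → ℝ) : ℝ :=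
  ∫ θ, principalUtility r θ t ∂D

/-- The empirical utility `U_p(S, t)` of the principal on the sample `S`. -/
noncomputable def empiricalUtility (r : Fin m → ℝ) {s : ℕ} (S : Fin s → AgentType n m)
    (t : Fin m → ℝ) : ℝ :=
  (1 / (s : ℝ)) * ∑ k, principalUtility r (S k) t

/-! The integral defining `expectedUtility` always exists. -/

theorem measurable_f (i : Fin n) (j : Fin m) :
    Measurable fun θ : AgentType n m => θ.f i j := by
  have h : Measurable fun θ : AgentType n m => (θ.f, θ.c) := comap_measurable _
  exact (measurable_pi_apply j).comp ((measurable_pi_apply i).comp h.fst)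

theorem measurable_c (i : Fin n) : Measurable fun θ : AgentType n m => θ.c i := by
  have h : Measurable fun θ : AgentType n m => (θ.f, θ.c) := comap_measurable _
  exact (measurable_pi_apply i).comp h.snd

theorem measurable_principalUtility (r t : Fin m → ℝ) :
    Measurable fun θ : AgentType n m => principalUtility r θ t := by
  have hA : ∀ i, Measurable fun θ : AgentType n m => agentUtility θ t i := fun i =>
    (Finset.measurable_sum _ fun j _ => (measurable_f i j).mul_const _).sub (measurable_c i)
  have hV : ∀ i, Measurable fun θ : AgentType n m => actionValue r θ t i := fun i =>
    Finset.measurable_sum _ fun j _ => (measurable_f i j).mul_const _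
  refine measurable_of_Ici fun x => ?_
  have : (fun θ : AgentType n m => principalUtility r θ t) ⁻¹' Set.Ici x =
      ⋃ i, (⋂ k, {θ | agentUtility θ t k ≤ agentUtility θ t i}) ∩
        {θ | x ≤ actionValue r θ t i} := by
    ext θ
    simp only [Set.mem_preimage, Set.mem_Ici, Set.mem_iUnion, Set.mem_inter_iff, Set.mem_iInter,
      Set.mem_ofPred_eq]
    exact ⟨fun h => ⟨_, (chosenAction_spec r θ t).1, h⟩,
      fun ⟨i, hi, h⟩ => h.trans ((chosenAction_spec r θ t).2 i hi)⟩
  rw [this]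
  exact MeasurableSet.iUnion fun i =>
    (MeasurableSet.iInter fun k => measurableSet_le (hA k) (hA i)).inter
      (measurableSet_le measurable_const (hV i))

theorem integrable_principalUtility (r t : Fin m → ℝ) (D : Measure (AgentType n m))
    [IsProbabilityMeasure D] : Integrable (fun θ => principalUtility r θ t) D := by
  refine Integrable.of_bound (measurable_principalUtility r t).aestronglyMeasurable
    (∑ j, |r j - t j|) (Filter.Eventually.of_forall fun θ => ?_)
  rw [Real.norm_eq_abs, principalUtility, actionValue]
  refine (Finset.abs_sum_le_sum_abs _ _).trans (Finset.sum_le_sum fun j _ => ?_)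
  have h := θ.f_mem (chosenAction r θ t)
  have h1 : θ.f (chosenAction r θ t) j ≤ 1 := by
    rw [← h.2]
    exact Finset.single_le_sum (f := θ.f (chosenAction r θ t)) (fun k _ => h.1 k)
      (Finset.mem_univ j)
  rw [abs_mul, abs_of_nonneg (h.1 j)]
  exact mul_le_of_le_one_left (abs_nonneg _) h1

end Contracts

/-! Under a linear contract the principal's utility factors as `(1 - α) * chosenReward r α θ`. Since
`1 - α` lies in `[0, 1]` and does not depend on the type, it suffices to control the deviations of
the chosen reward. For a fixed type this reward is monotone in `α` with values in `[0, 1]`, whatever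
`n` and `m` are, so a Dvoretzky–Kiefer–Wolfowitz bound applies
(`measure_exists_deviation_le_of_countable`).

For that bound, symmetrization against a ghost sample reduces the deviations to Rademacher sums. A
monotone `[0, 1]`-valued family is an average of indicators of chains of sets, and along a chain the
largest Rademacher sum is a maximum of partial sums. Lévy's inequality
(`exists_maximal_rademacher_sum`) then replaces a union bound and costs only a constant factor.
Markov's inequality finishes the estimate.

The bound is proved for countably many `α` and extended by right-continuity of the chosen reward
(`eventually_chosenReward_eq`), which rests on tie-breaking in the principal's favor. -/

namespace Contracts

/-! ### Rademacher sums along a chain of sets -/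

/-- The Lévy maximal inequality for Rademacher sums, for the threshold sets of `T`. -/
theorem exists_maximal_rademacher_sum {κ : Type*} [Fintype κ] [DecidableEq κ] (T : κ → ℕ)
    (F : Finset κ) :
    ∃ M : (κ → ℤˣ) → ℝ,
      (∀ σ, ∀ G ⊆ F, (∀ k ∈ G, ∀ l ∈ F, T l ≤ T k → l ∈ G) →
        ∑ k ∈ G, ((σ k : ℤ) : ℝ) ≤ M σ) ∧
      ∀ g : (κ → ℤˣ) → ℝ → ℝ, (∀ σ, Monotone (g σ)) → (∀ σ y, 0 ≤ g σ y) →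
        (∀ σ σ', (∀ k ∉ F, σ k = σ' k) → g σ = g σ') →
        ∑ σ, g σ (M σ) ≤ 2 * ∑ σ, g σ (∑ k ∈ F, ((σ k : ℤ) : ℝ)) := by
  induction F using Finset.induction_on_min_value T with
  | empty =>
    refine ⟨fun _ => 0, fun σ G hG _ => by simp [Finset.subset_empty.1 hG], ?_⟩
    intro g _ h0 _
    simp only [Finset.sum_empty]
    have := Finset.sum_nonneg fun (σ : κ → ℤˣ) (_ : σ ∈ Finset.univ) => h0 σ 0
    linarith
  | insert a F ha hmin ih =>
    obtain ⟨M, hM, hg⟩ := ih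
    -- Since `a` has the least threshold, every nonempty threshold set contains it; the 0 accounts
    -- for the empty set.
    refine ⟨fun σ => max 0 (((σ a : ℤ) : ℝ) + M σ), ?_, ?_⟩
    · intro σ G hG hlow
      rcases G.eq_empty_or_nonempty with rfl | ⟨k, hk⟩
      · simp
      refine le_max_of_le_right ?_
      have haG : a ∈ G := by
        refine hlow k hk a (Finset.mem_insert_self _ _) ?_
        rcases Finset.mem_insert.1 (hG hk) with rfl | h
        · exact le_rfl
        · exact hmin _ h
      rw [← Finset.add_sum_erase _ _ haG]
      refine add_le_add le_rfl (hM σ _ ?_ ?_)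
      · intro l hl
        rw [Finset.mem_erase] at hl
        exact (Finset.mem_insert.1 (hG hl.2)).resolve_left hl.1
      · intro l hl l' hl' hT
        refine Finset.mem_erase.2 ⟨fun h => ha (h ▸ hl'), ?_⟩
        exact hlow l (Finset.mem_of_mem_erase hl) l' (Finset.mem_insert_of_mem hl') hT
    · intro g hmono h0 hdep
      -- The induction hypothesis is applied to the excess over `g σ 0`. Test functions may depend
      -- on signs outside `F`, so the shift by `σ a` is allowed.
      have hIH := hg (fun σ y => max (g σ (((σ a : ℤ) : ℝ) + y) - g σ 0) 0)
        (fun σ x y hxy => max_le_max (sub_le_sub_right (hmono σ (by linarith)) _) le_rfl)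
        (fun σ y => le_max_right _ _)
        (fun σ σ' h => by
          have h1 : g σ = g σ' := hdep σ σ' fun k hk =>
            h k fun hk' => hk (Finset.mem_insert_of_mem hk')
          simp only [h1, h a ha])
      set S : (κ → ℤˣ) → ℝ := fun σ => ∑ k ∈ insert a F, ((σ k : ℤ) : ℝ) with hS
      let flip : (κ → ℤˣ) → (κ → ℤˣ) := fun σ k => if k ∈ insert a F then -σ k else σ k
      have hflip : Function.Involutive flip := by
        intro σ
        funext k
        by_cases hk : k ∈ insert a F
        · simp only [flip, if_pos hk, neg_neg]
        · simp only [flip, if_neg hk]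
      have hSflip : ∀ σ, S (flip σ) = - S σ := by
        intro σ
        simp only [hS, ← Finset.sum_neg_distrib]
        refine Finset.sum_congr rfl fun k hk => ?_
        simp only [flip, if_pos hk]
        push_cast
        rfl
      have hgflip : ∀ σ, g (flip σ) = g σ := fun σ =>
        hdep _ _ fun k hk => by simp only [flip, if_neg hk]
      have hsymm : ∑ σ, min (g σ (S σ)) (g σ 0) = ∑ σ, min (g σ (-S σ)) (g σ 0) := by
        rw [← Equiv.sum_comp hflip.toPerm]
        refine Finset.sum_congr rfl fun σ _ => ?_
        simp only [Function.Involutive.coe_toPerm, hSflip, hgflip]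
      -- Flipping all signs in `insert a F` negates `S` and fixes `g`; one of `S σ`, `-S σ` is
      -- nonnegative, and there the minimum is `g σ 0`.
      have hhalf : ∑ σ, g σ 0 ≤ 2 * ∑ σ, min (g σ (S σ)) (g σ 0) := by
        rw [two_mul]
        nth_rewrite 2 [hsymm]
        rw [← Finset.sum_add_distrib]
        refine Finset.sum_le_sum fun σ _ => ?_
        rcases le_total 0 (S σ) with h | h
        · have h1 : min (g σ (S σ)) (g σ 0) = g σ 0 := min_eq_right (hmono σ h)
          have h2 : 0 ≤ min (g σ (-S σ)) (g σ 0) := le_min (h0 _ _) (h0 _ _)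
          linarith
        · have h1 : min (g σ (-S σ)) (g σ 0) = g σ 0 := min_eq_right (hmono σ (by linarith))
          have h2 : 0 ≤ min (g σ (S σ)) (g σ 0) := le_min (h0 _ _) (h0 _ _)
          linarith
      have hsplit : ∑ σ, g σ (S σ) =
          ∑ σ, max (g σ (S σ) - g σ 0) 0 + ∑ σ, min (g σ (S σ)) (g σ 0) := by
        rw [← Finset.sum_add_distrib]
        refine Finset.sum_congr rfl fun σ _ => ?_
        rcases le_total (g σ (S σ)) (g σ 0) with h | h
        · rw [max_eq_right (by linarith), min_eq_left h]; ring
        · rw [max_eq_left (by linarith), min_eq_right h]; ring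
      have hle : ∑ σ, g σ (max 0 (((σ a : ℤ) : ℝ) + M σ)) ≤
          ∑ σ, max (g σ (((σ a : ℤ) : ℝ) + M σ) - g σ 0) 0 + ∑ σ, g σ 0 := by
        rw [← Finset.sum_add_distrib]
        refine Finset.sum_le_sum fun σ _ => ?_
        rcases le_total 0 (((σ a : ℤ) : ℝ) + M σ) with h | h
        · rw [max_eq_right h]
          have := le_max_left (g σ (((σ a : ℤ) : ℝ) + M σ) - g σ 0) 0
          linarith
        · rw [max_eq_left h]
          have := le_max_right (g σ (((σ a : ℤ) : ℝ) + M σ) - g σ 0) 0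
          linarith
      have hIH' : ∑ σ, max (g σ (((σ a : ℤ) : ℝ) + M σ) - g σ 0) 0 ≤
          2 * ∑ σ, max (g σ (S σ) - g σ 0) 0 := by
        simpa only [hS, Finset.sum_insert ha] using hIH
      rw [hsplit]
      linarith

/-- The exponential moment of a sum of independent Rademacher variables. -/
theorem sum_exp_rademacher {κ : Type*} [Fintype κ] [DecidableEq κ] (μ : ℝ) :
    ∑ σ : κ → ℤˣ, Real.exp (μ * ∑ k, ((σ k : ℤ) : ℝ)) =
      (2 * Real.cosh μ) ^ Fintype.card κ := by
  have h := Finset.prod_univ_sum (fun _ : κ => (Finset.univ : Finset ℤˣ))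
    (fun _ x => Real.exp (μ * ((x : ℤ) : ℝ)))
  rw [Fintype.piFinset_univ] at h
  simp only [Finset.mul_sum, Real.exp_sum]
  rw [← h, Finset.prod_const, Finset.card_univ]
  congr 1
  rw [Real.cosh_eq, show (Finset.univ : Finset ℤˣ) = {1, -1} from rfl,
    Finset.sum_pair (by decide)]
  simp
  ring

/-- The maximum of Rademacher sums over a chain of index sets has a Gaussian exponential moment. -/
theorem sum_exp_sup_rademacher_chain {ι κ : Type*} [LinearOrder ι] [Fintype κ] [DecidableEq κ]
    (A : Finset ι) (hA : A.Nonempty) (B : ι → Finset κ) (hB : Monotone B) {μ : ℝ} (hμ : 0 ≤ μ) :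
    ∑ σ : κ → ℤˣ, Real.exp (μ * A.sup' hA fun a => |∑ k ∈ B a, ((σ k : ℤ) : ℝ)|) ≤
      4 * (2 * Real.cosh μ) ^ Fintype.card κ := by
  -- The threshold of `k` counts the indices in `A` at which `k` has not yet entered the chain, so
  -- each `B a` with `a ∈ A` is a threshold set.
  obtain ⟨M, hM, hg⟩ := exists_maximal_rademacher_sum
    (fun k => (A.filter fun a => k ∉ B a).card) Finset.univ
  have hMB : ∀ σ, ∀ a ∈ A, ∑ k ∈ B a, ((σ k : ℤ) : ℝ) ≤ M σ := by
    intro σ a ha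
    refine hM σ _ (Finset.subset_univ _) fun k hk l _ hT => ?_
    by_contra hl
    refine absurd hT (not_le.2 (Finset.card_lt_card ?_))
    refine (Finset.ssubset_iff_of_subset fun b hb => ?_).2 ⟨a, ?_, ?_⟩
    · rw [Finset.mem_filter] at hb ⊢
      refine ⟨hb.1, fun h => ?_⟩
      rcases le_total a b with hab | hab
      · exact hb.2 (hB hab hk)
      · exact hl (hB hab h)
    · exact Finset.mem_filter.2 ⟨ha, hl⟩
    · exact fun h => (Finset.mem_filter.1 h).2 hk
  have hE : ∑ σ, Real.exp (μ * M σ) ≤ 2 * (2 * Real.cosh μ) ^ Fintype.card κ := by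
    rw [← sum_exp_rademacher]
    exact hg (fun _ y => Real.exp (μ * y))
      (fun _ x y h => Real.exp_le_exp.2 (mul_le_mul_of_nonneg_left h hμ))
      (fun _ _ => (Real.exp_pos _).le) (fun _ _ _ => rfl)
  have hE' : ∑ σ, Real.exp (μ * M (-σ)) = ∑ σ, Real.exp (μ * M σ) :=
    Equiv.sum_comp (Equiv.mk (fun σ : κ → ℤˣ => fun k => -σ k) (fun σ k => -σ k)
      (fun σ => by simp) (fun σ => by simp)) fun σ => Real.exp (μ * M σ)
  -- The absolute value is handled by also using `-σ`, which doubles the constant 2 to 4.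
  calc _ ≤ ∑ σ, (Real.exp (μ * M σ) + Real.exp (μ * M (-σ))) := by
        refine Finset.sum_le_sum fun σ _ => ?_
        obtain ⟨a, ha, h⟩ := Finset.exists_mem_eq_sup' hA
          fun a => |∑ k ∈ B a, ((σ k : ℤ) : ℝ)|
        rw [h]
        rcases abs_choice (∑ k ∈ B a, ((σ k : ℤ) : ℝ)) with h | h <;> rw [h]
        · refine le_add_of_le_of_nonneg ?_ (Real.exp_pos _).le
          exact Real.exp_le_exp.2 (mul_le_mul_of_nonneg_left (hMB σ a ha) hμ)
        · refine le_add_of_nonneg_of_le (Real.exp_pos _).le ?_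
          refine Real.exp_le_exp.2 (mul_le_mul_of_nonneg_left ?_ hμ)
          have := hMB (-σ) a ha
          rw [← Finset.sum_neg_distrib]
          simpa using this
    _ ≤ _ := by
        rw [Finset.sum_add_distrib, hE']
        linarith


/-! ### Monotone families and symmetrization -/

theorem integral_map_of_measurePreserving {α β : Type*} [MeasurableSpace α] [MeasurableSpace β]
    {P : Measure α} {Q : Measure β} {φ : α → β} (hφ : MeasurePreserving φ P Q) {g : β → ℝ}
    (hg : Measurable g) : ∫ x, g (φ x) ∂P = ∫ y, g y ∂Q := by
  rw [← hφ.map_eq, integral_map hφ.measurable.aemeasurable hg.aestronglyMeasurable]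

/-- Jensen's inequality for `x ↦ exp (μ * |x|)`, followed by a pointwise bound. -/
theorem exp_mul_abs_integral_le {Ω : Type*} [MeasurableSpace Ω] {P : Measure Ω}
    [IsProbabilityMeasure P] {X G : Ω → ℝ} (hX : Integrable X P) (hG : Integrable G P) {μ : ℝ}
    (hμ : 0 ≤ μ) (h : ∀ x, Real.exp (μ * |X x|) ≤ G x) :
    Real.exp (μ * |∫ x, X x ∂P|) ≤ ∫ x, G x ∂P := by
  have hi : Integrable (fun x => Real.exp (μ * |X x|)) P :=
    hG.mono' (Real.continuous_exp.comp_aestronglyMeasurable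
      (hX.abs.aestronglyMeasurable.const_mul μ)) (Filter.Eventually.of_forall fun x => by
        rw [Real.norm_eq_abs, abs_of_pos (Real.exp_pos _)]; exact h x)
  calc _ ≤ Real.exp (∫ x, μ * |X x| ∂P) := by
        rw [integral_const_mul]
        exact Real.exp_le_exp.2 (mul_le_mul_of_nonneg_left abs_integral_le_integral_abs hμ)
    _ ≤ ∫ x, Real.exp (μ * |X x|) ∂P :=
        convexOn_exp.map_integral_le Real.continuous_exp.continuousOn isClosed_univ
          (Filter.Eventually.of_forall fun _ => Set.mem_univ _) (hX.abs.const_mul μ) hi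
    _ ≤ _ := integral_mono hi hG h

/-- The maximum of a symmetrized monotone family of `[0, 1]`-valued functions on a finite set has a
Gaussian exponential moment. -/
theorem sum_exp_sup_rademacher_monotone {ι κ : Type*} [LinearOrder ι] [Fintype κ]
    [DecidableEq κ] (A : Finset ι) (hA : A.Nonempty) (v : ι → κ → ℝ) (hv : Monotone v)
    (hv01 : ∀ a k, v a k ∈ Set.Icc (0 : ℝ) 1) {μ : ℝ} (hμ : 0 ≤ μ) :
    ∑ σ : κ → ℤˣ, Real.exp (μ * A.sup' hA fun a => |∑ k, ((σ k : ℤ) : ℝ) * v a k|) ≤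
      4 * (2 * Real.cosh μ) ^ Fintype.card κ := by
  classical
  -- Layer-cake formula: `v a k` is the integral over `x ∈ [0, 1]` of the indicator of `x < v a k`.
  -- For fixed `x` the superlevel sets form a chain in `a`; Jensen moves the integral outside the
  -- exponential.
  let P : Measure ℝ := volume.restrict (Set.Icc 0 1)
  have hP : IsProbabilityMeasure P := ⟨by simp [P]⟩
  let B : ℝ → ι → Finset κ := fun x a => Finset.univ.filter fun k => x < v a k
  have hB : ∀ x, Monotone (B x) := fun x a b hab k hk => by
    simp only [B, Finset.mem_filter, Finset.mem_univ, true_and] at hk ⊢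
    exact hk.trans_le (hv hab k)
  let X : (κ → ℤˣ) → ι → ℝ → ℝ := fun σ a x => ∑ k ∈ B x a, ((σ k : ℤ) : ℝ)
  have hX : ∀ σ a x, X σ a x = ∑ k, ((σ k : ℤ) : ℝ) * (Set.Iio (v a k)).indicator 1 x := by
    intro σ a x
    simp only [X, B, Finset.sum_filter, Set.indicator_apply, Set.mem_Iio, Pi.one_apply, mul_ite,
      mul_one, mul_zero]
  have hXm : ∀ σ a, Measurable (X σ a) := by
    intro σ a
    rw [show X σ a = _ from funext (hX σ a)]
    exact Finset.measurable_sum _ fun k _ =>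
      (measurable_one.indicator measurableSet_Iio).const_mul _
  have hXb : ∀ σ a x, |X σ a x| ≤ Fintype.card κ := by
    intro σ a x
    refine (Finset.abs_sum_le_sum_abs _ _).trans ?_
    have : ∀ k, |((σ k : ℤ) : ℝ)| = 1 := fun k => by
      rcases Int.units_eq_one_or (σ k) with h | h <;> simp [h]
    simp only [this, Finset.sum_const, nsmul_eq_mul, mul_one]
    exact_mod_cast Finset.card_le_univ _
  have hXi : ∀ σ a, Integrable (X σ a) P := fun σ a =>
    Integrable.of_bound (hXm σ a).aestronglyMeasurable _
      (Filter.Eventually.of_forall (hXb σ a))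
  have hint : ∀ σ a, ∫ x, X σ a x ∂P = ∑ k, ((σ k : ℤ) : ℝ) * v a k := by
    intro σ a
    simp only [hX]
    have h1 : Integrable (1 : ℝ → ℝ) P := integrable_const 1
    rw [integral_finsetSum _ fun k _ => (h1.indicator measurableSet_Iio).const_mul _]
    refine Finset.sum_congr rfl fun k _ => ?_
    rw [integral_const_mul]
    congr 1
    rw [integral_indicator_one measurableSet_Iio, measureReal_def,
      Measure.restrict_apply measurableSet_Iio]
    have : Set.Iio (v a k) ∩ Set.Icc 0 1 = Set.Ico 0 (v a k) := by
      ext x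
      simp only [Set.mem_inter_iff, Set.mem_Iio, Set.mem_Icc, Set.mem_Ico]
      exact ⟨fun h => ⟨h.2.1, h.1⟩, fun h => ⟨h.2, h.1, h.2.le.trans (hv01 a k).2⟩⟩
    rw [this, Real.volume_Ico, sub_zero, ENNReal.toReal_ofReal (hv01 a k).1]
  let G : (κ → ℤˣ) → ℝ → ℝ := fun σ x => Real.exp (μ * A.sup' hA fun a => |X σ a x|)
  have hGi : ∀ σ, Integrable (G σ) P := by
    intro σ
    have hm : Measurable fun x => A.sup' hA fun a => |X σ a x| := by
      have := Finset.measurable_sup' (f := fun a x => |X σ a x|) hA fun a _ => (hXm σ a).abs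
      convert this using 2 with x
      rw [Finset.sup'_apply]
    refine Integrable.of_bound (hm.const_mul μ).exp.aestronglyMeasurable
      (Real.exp (μ * Fintype.card κ)) (Filter.Eventually.of_forall fun x => ?_)
    rw [Real.norm_eq_abs, abs_of_pos (Real.exp_pos _)]
    exact Real.exp_le_exp.2 (mul_le_mul_of_nonneg_left
      (Finset.sup'_le _ _ fun a _ => hXb σ a x) hμ)
  calc _ ≤ ∑ σ, ∫ x, G σ x ∂P := by
        refine Finset.sum_le_sum fun σ _ => ?_
        obtain ⟨a, ha, h⟩ := Finset.exists_mem_eq_sup' hA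
          fun a => |∑ k, ((σ k : ℤ) : ℝ) * v a k|
        rw [h, ← hint]
        exact exp_mul_abs_integral_le (hXi σ a) (hGi σ) hμ fun x => Real.exp_le_exp.2
          (mul_le_mul_of_nonneg_left (Finset.le_sup' (fun a => |X σ a x|) ha) hμ)
    _ = ∫ x, ∑ σ, G σ x ∂P := (integral_finsetSum _ fun σ _ => hGi σ).symm
    _ ≤ ∫ x, 4 * (2 * Real.cosh μ) ^ Fintype.card κ ∂P :=
        integral_mono (integrable_finsetSum _ fun σ _ => hGi σ) (integrable_const _)
          fun x => sum_exp_sup_rademacher_chain A hA (B x) (hB x) hμ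
    _ = _ := by simp

/-- Symmetrization: the uniform deviation of the empirical sums of a monotone family of
`[0, 1]`-valued functions has a Gaussian exponential moment. -/
theorem integral_exp_sup_deviation_le {Ω ι κ : Type*} [MeasurableSpace Ω] [LinearOrder ι]
    [Fintype κ] (D : Measure Ω) [IsProbabilityMeasure D] (A : Finset ι) (hA : A.Nonempty)
    (f : ι → Ω → ℝ) (hf : Monotone f) (hfm : ∀ a, Measurable (f a))
    (hf01 : ∀ a x, f a x ∈ Set.Icc (0 : ℝ) 1) {μ : ℝ} (hμ : 0 ≤ μ) :
    Integrable (fun ω => Real.exp (μ * A.sup' hA fun a => |∑ k, (f a (ω k) - ∫ x, f a x ∂D)|))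
      (Measure.pi fun _ : κ => D) ∧
    ∫ ω, Real.exp (μ * A.sup' hA fun a => |∑ k, (f a (ω k) - ∫ x, f a x ∂D)|)
      ∂(Measure.pi fun _ : κ => D) ≤ 4 * Real.exp (2 * μ ^ 2 * Fintype.card κ) := by
  classical
  have hsupm : ∀ {Ω' : Type _} [MeasurableSpace Ω'] (X : ι → Ω' → ℝ), (∀ a, Measurable (X a)) →
      Measurable fun x => Real.exp (μ * A.sup' hA fun a => |X a x|) := by
    intro Ω' _ X hX
    have := Finset.measurable_sup' (f := fun a x => |X a x|) hA fun a _ => (hX a).abs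
    refine (Measurable.const_mul ?_ μ).exp
    convert this using 2 with x
    rw [Finset.sup'_apply]
  have hsupi : ∀ {Ω' : Type _} [MeasurableSpace Ω'] (P : Measure Ω') [IsProbabilityMeasure P]
      (X : ι → Ω' → ℝ), (∀ a, Measurable (X a)) → (∀ a x, |X a x| ≤ Fintype.card κ) →
      Integrable (fun x => Real.exp (μ * A.sup' hA fun a => |X a x|)) P := by
    intro Ω' _ P _ X hX hb
    refine Integrable.of_bound (hsupm X hX).aestronglyMeasurable
      (Real.exp (μ * Fintype.card κ)) (Filter.Eventually.of_forall fun x => ?_)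
    rw [Real.norm_eq_abs, abs_of_pos (Real.exp_pos _)]
    exact Real.exp_le_exp.2 (mul_le_mul_of_nonneg_left
      (Finset.sup'_le _ _ fun a _ => hb a x) hμ)
  have hfi : ∀ a, Integrable (f a) D := fun a =>
    Integrable.of_bound (hfm a).aestronglyMeasurable 1 (Filter.Eventually.of_forall fun x => by
      rw [Real.norm_eq_abs, abs_of_nonneg (hf01 a x).1]; exact (hf01 a x).2)
  have hE01 : ∀ a, ∫ x, f a x ∂D ∈ Set.Icc (0 : ℝ) 1 := fun a =>
    ⟨integral_nonneg fun x => (hf01 a x).1, by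
      simpa using integral_mono (hfi a) (integrable_const 1) fun x => (hf01 a x).2⟩
  have hsum_le : ∀ u : κ → ℝ, (∀ k, |u k| ≤ 1) → |∑ k, u k| ≤ Fintype.card κ := by
    intro u hu
    refine (Finset.abs_sum_le_sum_abs _ _).trans ((Finset.sum_le_sum fun k _ => hu k).trans ?_)
    simp
  have hdiff : ∀ {x y : ℝ}, x ∈ Set.Icc (0 : ℝ) 1 → y ∈ Set.Icc (0 : ℝ) 1 → |x - y| ≤ 1 :=
    fun hx hy => abs_le.2 ⟨by linarith [hx.1, hy.2], by linarith [hx.2, hy.1]⟩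
  have hint := hsupi (Measure.pi fun _ : κ => D)
    (fun a ω => ∑ k, (f a (ω k) - ∫ x, f a x ∂D))
    (fun a => Finset.measurable_sum _ fun k _ =>
      ((hfm a).comp (measurable_pi_apply k)).sub_const _)
    (fun a ω => hsum_le _ fun k => hdiff (hf01 _ _) (hE01 a))
  refine ⟨hint, ?_⟩
  let Y : (κ → ℤˣ) → ι → (κ → Ω × Ω) → ℝ := fun σ a z =>
    ∑ k, ((σ k : ℤ) : ℝ) * (f a (z k).1 - f a (z k).2)
  let H : (κ → ℤˣ) → (κ → Ω × Ω) → ℝ := fun σ z =>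
    Real.exp (μ * A.sup' hA fun a => |Y σ a z|)
  have habs : ∀ (σ : κ → ℤˣ) k, |((σ k : ℤ) : ℝ)| = 1 := fun σ k => by
    rcases Int.units_eq_one_or (σ k) with h | h <;> simp [h]
  have hYm : ∀ σ a, Measurable (Y σ a) := fun σ a => Finset.measurable_sum _ fun k _ =>
    (((hfm a).comp (measurable_pi_apply k).fst).sub
      ((hfm a).comp (measurable_pi_apply k).snd)).const_mul _
  have hHi : ∀ σ, Integrable (H σ) (Measure.pi fun _ : κ => D.prod D) := fun σ =>
    hsupi _ (Y σ) (hYm σ) fun a z => hsum_le _ fun k => by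
      rw [abs_mul, habs, one_mul]; exact hdiff (hf01 _ _) (hf01 _ _)
  -- Exchanging a sample point with its ghost wherever `σ k = -1` preserves the product measure.
  have hswap : ∀ σ, ∫ z, H σ z ∂(Measure.pi fun _ : κ => D.prod D) =
      ∫ z, H 1 z ∂(Measure.pi fun _ : κ => D.prod D) := by
    intro σ
    have hmp : MeasurePreserving
        (fun (z : κ → Ω × Ω) k => (if σ k = 1 then id else Prod.swap) (z k))
        (Measure.pi fun _ : κ => D.prod D) (Measure.pi fun _ : κ => D.prod D) := by
      refine measurePreserving_pi _ _ (f := fun k => if σ k = 1 then id else Prod.swap)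
        fun k => ?_
      split_ifs
      · exact MeasurePreserving.id _
      · exact Measure.measurePreserving_swap
    have h1 : ∀ z, H σ z =
        H 1 (fun k => (if σ k = 1 then id else Prod.swap) (z k)) := by
      intro z
      have h2 : ∀ a, Y σ a z = Y 1 a (fun k => (if σ k = 1 then id else Prod.swap) (z k)) := by
        intro a
        refine Finset.sum_congr rfl fun k _ => ?_
        rcases Int.units_eq_one_or (σ k) with h | h <;> simp [h]
      simp only [H, h2]
    simp only [h1]
    exact integral_map_of_measurePreserving hmp (hsupm _ (hYm 1))
  have hpt : ∀ z : κ → Ω × Ω, ∑ σ, H σ z ≤ 4 * (2 * Real.cosh (2 * μ)) ^ Fintype.card κ := by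
    intro z
    let N : (κ → ℤˣ) → (κ → Ω) → ℝ := fun σ w =>
      A.sup' hA fun a => |∑ k, ((σ k : ℤ) : ℝ) * f a (w k)|
    have hN : ∀ w : κ → Ω, ∑ σ, Real.exp (2 * μ * N σ w) ≤
        4 * (2 * Real.cosh (2 * μ)) ^ Fintype.card κ := fun w =>
      sum_exp_sup_rademacher_monotone A hA (fun a k => f a (w k)) (fun a b hab k => hf hab _)
        (fun a k => hf01 _ _) (by positivity)
    -- The triangle inequality separates sample and ghost; then `2 * x * y ≤ x ^ 2 + y ^ 2`
    -- decouples the exponentials, at the price of doubling `μ`.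
    have hle : ∀ σ, H σ z ≤ (Real.exp (2 * μ * N σ fun k => (z k).1) +
        Real.exp (2 * μ * N σ fun k => (z k).2)) / 2 := by
      intro σ
      have h1 : (A.sup' hA fun a => |Y σ a z|) ≤
          (N σ fun k => (z k).1) + N σ fun k => (z k).2 := by
        refine Finset.sup'_le _ _ fun a ha => ?_
        have h2 : Y σ a z = ∑ k, ((σ k : ℤ) : ℝ) * f a (z k).1 -
            ∑ k, ((σ k : ℤ) : ℝ) * f a (z k).2 := by
          simp only [Y, mul_sub, Finset.sum_sub_distrib]
        rw [h2]
        exact (abs_sub _ _).trans (add_le_add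
          (Finset.le_sup' (fun a => |∑ k, ((σ k : ℤ) : ℝ) * f a (z k).1|) ha)
          (Finset.le_sup' (fun a => |∑ k, ((σ k : ℤ) : ℝ) * f a (z k).2|) ha))
      refine (Real.exp_le_exp.2 (mul_le_mul_of_nonneg_left h1 hμ)).trans ?_
      have h3 := two_mul_le_add_sq (Real.exp (μ * N σ fun k => (z k).1))
        (Real.exp (μ * N σ fun k => (z k).2))
      simp only [← Real.exp_nat_mul] at h3
      rw [mul_add, Real.exp_add]
      push_cast at h3
      simp only [← mul_assoc] at h3 ⊢
      linarith
    calc _ ≤ _ := Finset.sum_le_sum fun σ _ => hle σ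
      _ = (∑ σ, Real.exp (2 * μ * N σ fun k => (z k).1) +
          ∑ σ, Real.exp (2 * μ * N σ fun k => (z k).2)) / 2 := by
        rw [← Finset.sum_add_distrib, Finset.sum_div]
      _ ≤ _ := by linarith [hN fun k => (z k).1, hN fun k => (z k).2]
  have hH1 : ∫ z, H 1 z ∂(Measure.pi fun _ : κ => D.prod D) ≤
      4 * Real.exp (2 * μ ^ 2 * Fintype.card κ) := by
    -- All `2 ^ Fintype.card κ` sign patterns have the same integral, so it is bounded by averaging
    -- over them.
    have h1 : (2 : ℝ) ^ Fintype.card κ * ∫ z, H 1 z ∂(Measure.pi fun _ : κ => D.prod D) ≤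
        4 * (2 * Real.cosh (2 * μ)) ^ Fintype.card κ := by
      calc _ = ∑ σ : κ → ℤˣ, ∫ z, H σ z ∂(Measure.pi fun _ : κ => D.prod D) := by
            simp [hswap]
        _ = ∫ z, ∑ σ, H σ z ∂(Measure.pi fun _ : κ => D.prod D) :=
            (integral_finsetSum _ fun σ _ => hHi σ).symm
        _ ≤ ∫ z, 4 * (2 * Real.cosh (2 * μ)) ^ Fintype.card κ
              ∂(Measure.pi fun _ : κ => D.prod D) :=
            integral_mono (integrable_finsetSum _ fun σ _ => hHi σ) (integrable_const _) hpt
        _ = _ := by simp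
    have h2 : Real.cosh (2 * μ) ^ Fintype.card κ ≤ Real.exp (2 * μ ^ 2 * Fintype.card κ) := by
      refine (pow_le_pow_left₀ (Real.cosh_pos _).le (Real.cosh_le_exp_half_sq _) _).trans ?_
      rw [← Real.exp_nat_mul]
      exact Real.exp_le_exp.2 (le_of_eq (by ring))
    rw [mul_pow] at h1
    have h3 : (0 : ℝ) < 2 ^ Fintype.card κ := by positivity
    have h4 := le_of_mul_le_mul_left (h1.trans_eq (mul_left_comm _ _ _)) h3
    linarith
  refine le_trans ?_ hH1
  have hmp := measurePreserving_arrowProdEquivProdArrow Ω Ω κ (fun _ => D) (fun _ => D)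
  let K : (κ → Ω) × (κ → Ω) → ℝ := fun p =>
    Real.exp (μ * A.sup' hA fun a => |∑ k, (f a (p.1 k) - f a (p.2 k))|)
  have hKm : ∀ a, Measurable fun p : (κ → Ω) × (κ → Ω) => ∑ k, (f a (p.1 k) - f a (p.2 k)) :=
    fun a => Finset.measurable_sum _ fun k _ =>
      ((hfm a).comp ((measurable_pi_apply k).comp measurable_fst)).sub
        ((hfm a).comp ((measurable_pi_apply k).comp measurable_snd))
  have hKi : Integrable K ((Measure.pi fun _ : κ => D).prod (Measure.pi fun _ : κ => D)) :=
    hsupi _ _ hKm fun a p => hsum_le _ fun k => hdiff (hf01 _ _) (hf01 _ _)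
  have hHK : ∫ z, H 1 z ∂(Measure.pi fun _ : κ => D.prod D) =
      ∫ p, K p ∂((Measure.pi fun _ : κ => D).prod (Measure.pi fun _ : κ => D)) := by
    rw [← hmp.integral_comp' K]
    refine integral_congr_ae (Filter.Eventually.of_forall fun z => ?_)
    simp [H, K, Y, MeasurableEquiv.arrowProdEquivProdArrow, Equiv.arrowProdEquivProdArrow]
  rw [hHK, integral_prod _ hKi]
  refine integral_mono hint hKi.integral_prod_left fun ω => ?_
  -- For fixed `ω` each mean is an integral over the ghost sample `ω'`, so Jensen applies at the
  -- maximizing index.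
  obtain ⟨a, ha, h⟩ := Finset.exists_mem_eq_sup' hA
    fun a => |∑ k, (f a (ω k) - ∫ x, f a x ∂D)|
  have hki : ∀ k : κ, Integrable (fun ω' : κ → Ω => f a (ω k) - f a (ω' k))
      (Measure.pi fun _ : κ => D) := fun k =>
    Integrable.of_bound ((((hfm a).comp (measurable_pi_apply k)).const_sub _).aestronglyMeasurable)
      1 (Filter.Eventually.of_forall fun ω' => hdiff (hf01 _ _) (hf01 _ _))
  have h5 : ∑ k, (f a (ω k) - ∫ x, f a x ∂D) =
      ∫ ω', ∑ k, (f a (ω k) - f a (ω' k)) ∂(Measure.pi fun _ : κ => D) := by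
    rw [integral_finsetSum _ fun k _ => hki k]
    refine Finset.sum_congr rfl fun k _ => ?_
    have hev := measurePreserving_eval (fun _ : κ => D) k
    have h6 : Integrable (fun ω' : κ → Ω => f a (ω' k)) (Measure.pi fun _ : κ => D) :=
      hev.integrable_comp_of_integrable (hfi a)
    rw [integral_sub (integrable_const _) h6]
    congr 1
    · simp
    · exact (integral_map_of_measurePreserving hev (hfm a)).symm
  simp only
  rw [h, h5]
  refine exp_mul_abs_integral_le (integrable_finsetSum _ fun k _ => hki k) ?_ hμ fun ω' =>
    Real.exp_le_exp.2 (mul_le_mul_of_nonneg_left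
      (Finset.le_sup' (fun a => |∑ k, (f a (ω k) - f a (ω' k))|) ha) hμ)
  exact hsupi _ _ (fun a => (hKm a).comp measurable_prodMk_left)
    fun a p => hsum_le _ fun k => hdiff (hf01 _ _) (hf01 _ _)


/-! ### Tail bounds for the uniform deviation -/

/-- Chernoff's method: with `N` sample points the exponent `2 * μ ^ 2 * N - μ * N * ε` is least at
`μ = ε / 4`, where it equals `-(N * ε ^ 2 / 8)`. -/
theorem measure_exists_deviation_le {Ω ι κ : Type*} [MeasurableSpace Ω] [LinearOrder ι]
    [Fintype κ] (D : Measure Ω) [IsProbabilityMeasure D] (A : Finset ι)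
    (f : ι → Ω → ℝ) (hf : Monotone f) (hfm : ∀ a, Measurable (f a))
    (hf01 : ∀ a x, f a x ∈ Set.Icc (0 : ℝ) 1) {ε : ℝ} (hε : 0 ≤ ε) :
    Measure.pi (fun _ : κ => D)
      {ω | ∃ a ∈ A, Fintype.card κ * ε < |∑ k, (f a (ω k) - ∫ x, f a x ∂D)|} ≤
      ENNReal.ofReal (4 * Real.exp (-(Fintype.card κ * ε ^ 2 / 8))) := by
  rcases A.eq_empty_or_nonempty with rfl | hA
  · simp
  obtain ⟨hint, hle⟩ := integral_exp_sup_deviation_le (κ := κ) D A hA f hf hfm hf01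
    (μ := ε / 4) (by positivity)
  have hmarkov := mul_meas_ge_le_integral_of_nonneg
    (Filter.Eventually.of_forall fun ω => (Real.exp_pos _).le) hint
    (Real.exp (ε / 4 * (Fintype.card κ * ε)))
  refine (measure_mono (t := {ω | Real.exp (ε / 4 * (Fintype.card κ * ε)) ≤
      Real.exp (ε / 4 * A.sup' hA fun a => |∑ k, (f a (ω k) - ∫ x, f a x ∂D)|)})
      fun ω hω => ?_).trans (ENNReal.le_ofReal_iff_toReal_le (measure_ne_top _ _)
    (by positivity) |>.2 ?_)
  · obtain ⟨a, ha, h⟩ := hω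
    exact Real.exp_le_exp.2 (mul_le_mul_of_nonneg_left (h.le.trans
      (Finset.le_sup' (fun a => |∑ k, (f a (ω k) - ∫ x, f a x ∂D)|) ha)) (by positivity))
  · rw [← measureReal_def]
    refine le_of_mul_le_mul_left ((hmarkov.trans hle).trans_eq ?_)
      (Real.exp_pos (ε / 4 * (Fintype.card κ * ε)))
    rw [mul_left_comm, ← Real.exp_add]
    congr 2
    ring

/-- A Dvoretzky–Kiefer–Wolfowitz inequality for countable monotone families of `[0, 1]`-valued
functions. -/
theorem measure_exists_deviation_le_of_countable {Ω ι κ : Type*} [MeasurableSpace Ω]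
    [LinearOrder ι] [Countable ι] [Fintype κ] (D : Measure Ω) [IsProbabilityMeasure D]
    (f : ι → Ω → ℝ) (hf : Monotone f) (hfm : ∀ a, Measurable (f a))
    (hf01 : ∀ a x, f a x ∈ Set.Icc (0 : ℝ) 1) {ε : ℝ} (hε : 0 ≤ ε) :
    Measure.pi (fun _ : κ => D)
      {ω | ∃ a, Fintype.card κ * ε < |∑ k, (f a (ω k) - ∫ x, f a x ∂D)|} ≤
      ENNReal.ofReal (4 * Real.exp (-(Fintype.card κ * ε ^ 2 / 8))) := by
  -- The bound does not depend on `A`, so it survives the directed union over finite index sets.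
  have h : {ω : κ → Ω | ∃ a, Fintype.card κ * ε < |∑ k, (f a (ω k) - ∫ x, f a x ∂D)|} =
      ⋃ A : Finset ι,
        {ω | ∃ a ∈ A, Fintype.card κ * ε < |∑ k, (f a (ω k) - ∫ x, f a x ∂D)|} := by
    ext ω
    simp only [Set.mem_ofPred_eq, Set.mem_iUnion]
    exact ⟨fun ⟨a, ha⟩ => ⟨{a}, a, Finset.mem_singleton_self a, ha⟩,
      fun ⟨_, a, _, ha⟩ => ⟨a, ha⟩⟩
  rw [h, Directed.measure_iUnion]
  · exact iSup_le fun A => measure_exists_deviation_le D A f hf hfm hf01 hε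
  · exact directed_of_isDirected_le fun A B (hAB : A ⊆ B) ω ⟨a, ha, h⟩ => ⟨a, hAB ha, h⟩

/-! ### Chosen rewards under linear contracts -/

variable {n m : ℕ} [NeZero n]

/-- The expected reward of action `i`. -/
def actionReward (r : Fin m → ℝ) (θ : AgentType n m) (i : Fin n) : ℝ := ∑ j, θ.f i j * r j

/-- The expected reward of the action that is chosen under the linear contract `α • r`. -/
noncomputable def chosenReward (r : Fin m → ℝ) (α : ℝ) (θ : AgentType n m) : ℝ :=
  actionReward r θ (chosenAction r θ (α • r))

theorem agentUtility_smul (r : Fin m → ℝ) (θ : AgentType n m) (α : ℝ) (i : Fin n) :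
    agentUtility θ (α • r) i = α * actionReward r θ i - θ.c i := by
  simp only [agentUtility, actionReward, Finset.mul_sum, Pi.smul_apply, smul_eq_mul]
  congr 1
  exact Finset.sum_congr rfl fun j _ => by ring

theorem actionValue_smul (r : Fin m → ℝ) (θ : AgentType n m) (α : ℝ) (i : Fin n) :
    actionValue r θ (α • r) i = (1 - α) * actionReward r θ i := by
  simp only [actionValue, actionReward, Finset.mul_sum, Pi.smul_apply, smul_eq_mul]
  exact Finset.sum_congr rfl fun j _ => by ring

theorem principalUtility_smul (r : Fin m → ℝ) (θ : AgentType n m) (α : ℝ) :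
    principalUtility r θ (α • r) = (1 - α) * chosenReward r α θ :=
  actionValue_smul r θ α _

theorem actionReward_mem_Icc {r : Fin m → ℝ} (hr : ∀ j, r j ∈ Set.Icc (0 : ℝ) 1)
    (θ : AgentType n m) (i : Fin n) : actionReward r θ i ∈ Set.Icc (0 : ℝ) 1 := by
  have h := θ.f_mem i
  refine ⟨Finset.sum_nonneg fun j _ => mul_nonneg (h.1 j) (hr j).1, ?_⟩
  rw [← h.2]
  exact Finset.sum_le_sum fun j _ => mul_le_of_le_one_right (h.1 j) (hr j).2

/-- Adding the two optimality inequalities cancels the costs and leaves `(β - α)` times the reward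
difference, which is therefore nonnegative. -/
theorem chosenReward_mono (r : Fin m → ℝ) (θ : AgentType n m) {α β : ℝ} (h : α ≤ β) :
    chosenReward r α θ ≤ chosenReward r β θ := by
  rcases h.eq_or_lt with rfl | h
  · exact le_rfl
  have h1 := (chosenAction_spec r θ (α • r)).1 (chosenAction r θ (β • r))
  have h2 := (chosenAction_spec r θ (β • r)).1 (chosenAction r θ (α • r))
  simp only [agentUtility_smul] at h1 h2
  simp only [chosenReward]
  by_contra! h3
  nlinarith

/-- The reward of the chosen action is locally constant to the right. -/
theorem eventually_chosenReward_eq (r : Fin m → ℝ) (θ : AgentType n m) {α : ℝ} (hα : α < 1) :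
    ∀ᶠ β in nhdsWithin α (Set.Ioi α), chosenReward r β θ = chosenReward r α θ := by
  have hspec := chosenAction_spec r θ (α • r)
  -- By tie-breaking and `1 - α > 0`, an action of larger reward is strictly suboptimal at `α`, and
  -- remains so nearby by continuity.
  have h : ∀ i, chosenReward r α θ < actionReward r θ i →
      ∀ᶠ β in nhdsWithin α (Set.Ioi α), ¬ IsBestAction θ (β • r) i := by
    intro i hi
    have hnb : ¬ IsBestAction θ (α • r) i := fun hb => by
      have := hspec.2 i hb
      simp only [actionValue_smul] at this
      exact absurd (le_of_mul_le_mul_left this (by linarith)) (not_le.2 hi)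
    obtain ⟨k, hk⟩ := not_forall.1 hnb
    simp only [agentUtility_smul, not_le] at hk
    have hcont : ∀ᶠ β in nhds α,
        β * actionReward r θ i - θ.c i < β * actionReward r θ k - θ.c k :=
      (by fun_prop : Continuous fun β : ℝ => β * actionReward r θ i - θ.c i).continuousAt
        |>.eventually_lt (by fun_prop) hk
    filter_upwards [nhdsWithin_le_nhds hcont] with β hβ hb
    have := hb k
    simp only [agentUtility_smul] at this
    linarith
  have h' : ∀ᶠ β in nhdsWithin α (Set.Ioi α), ∀ i,
      chosenReward r α θ < actionReward r θ i → ¬ IsBestAction θ (β • r) i :=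
    Filter.eventually_all.2 fun i => Filter.eventually_imp_distrib_left.2 (h i)
  filter_upwards [h', self_mem_nhdsWithin] with β hβ hαβ
  refine le_antisymm (not_lt.1 fun hlt => ?_) (chosenReward_mono r θ (le_of_lt hαβ))
  exact hβ _ hlt (chosenAction_spec r θ (β • r)).1

theorem measurable_chosenReward (r : Fin m → ℝ) {α : ℝ} (hα : α < 1) :
    Measurable fun θ : AgentType n m => chosenReward r α θ := by
  have h := (measurable_principalUtility (n := n) r (α • r)).const_mul (1 - α)⁻¹
  have h1 : (1 - α) ≠ 0 := by linarith
  simpa only [principalUtility_smul, inv_mul_cancel_left₀ h1] using h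

end Contracts

/-! ### Uniform convergence -/

open Contracts in
theorem theorem1 (n m : ℕ) [NeZero n] (r : Fin m → ℝ) (hr : ∀ j, r j ∈ Set.Icc (0 : ℝ) 1)
    (D : MeasureTheory.Measure (Contracts.AgentType n m)) [MeasureTheory.IsProbabilityMeasure D]
    (ε δ : ℝ) (hε : 0 < ε) (hδ : δ ∈ Set.Ioo (0 : ℝ) 1)
    (s : ℕ) (hs : 3456 * Real.log (4 / δ) / ε ^ 2 ≤ (s : ℝ)) :
    ∃ E : Set (Fin s → Contracts.AgentType n m), MeasurableSet E ∧
      ENNReal.ofReal (1 - δ) ≤ MeasureTheory.Measure.pi (fun _ : Fin s => D) E ∧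
      ∀ S ∈ E, ∀ α ∈ Set.Icc (0 : ℝ) 1,
        |Contracts.expectedUtility r D (α • r) - Contracts.empiricalUtility r S (α • r)| ≤ ε := by
  have hlog : 0 < Real.log (4 / δ) := Real.log_pos (by
    rw [lt_div_iff₀ hδ.1]; linarith [hδ.2])
  have hs0 : (0 : ℝ) < s := lt_of_lt_of_le (by positivity) hs
  -- Rational parameters make the bad event measurable; `q < 1` allows division by `1 - q` in the
  -- measurability proof.
  let f : {q : ℚ // (q : ℝ) < 1} → AgentType n m → ℝ := fun q θ => chosenReward r (q : ℚ) θ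
  have hf01 : ∀ (α : ℝ) (θ : AgentType n m), chosenReward r α θ ∈ Set.Icc (0 : ℝ) 1 := fun α θ =>
    actionReward_mem_Icc hr θ _
  have hfmeas : ∀ q, Measurable (f q) := fun q => measurable_chosenReward r q.2
  let bad : Set (Fin s → AgentType n m) :=
    {S | ∃ q, Fintype.card (Fin s) * ε < |∑ k, (f q (S k) - ∫ θ, f q θ ∂D)|}
  have hbadm : MeasurableSet bad := by
    simp only [bad, Set.ofPred_exists]
    refine MeasurableSet.iUnion fun q => measurableSet_lt measurable_const ?_
    exact (Finset.measurable_sum _ fun k _ =>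
      ((hfmeas q).comp (measurable_pi_apply k)).sub_const _).abs
  have hbad : Measure.pi (fun _ : Fin s => D) bad ≤ ENNReal.ofReal δ := by
    refine (measure_exists_deviation_le_of_countable D f
      (fun p q hpq θ => chosenReward_mono r θ (by exact_mod_cast hpq)) hfmeas
      (fun q θ => hf01 _ θ) hε.le).trans (ENNReal.ofReal_le_ofReal ?_)
    -- Only `s * ε ^ 2 ≥ 8 * log (4 / δ)` is needed here; 3456 leaves ample room.
    rw [div_le_iff₀ (by positivity)] at hs
    have h1 : Real.exp (-(Fintype.card (Fin s) * ε ^ 2 / 8)) ≤ Real.exp (-Real.log (4 / δ)) := by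
      rw [Fintype.card_fin]
      exact Real.exp_le_exp.2 (by linarith)
    rw [Real.exp_neg (Real.log _), Real.exp_log (div_pos four_pos hδ.1), inv_div] at h1
    linarith
  refine ⟨badᶜ, hbadm.compl, ?_, fun S hS α hα => ?_⟩
  · rw [prob_compl_eq_one_sub hbadm, ENNReal.ofReal_sub _ hδ.1.le, ENNReal.ofReal_one]
    exact tsub_le_tsub_left hbad _
  simp only [expectedUtility, empiricalUtility, principalUtility_smul]
  -- At `α = 1` both utilities vanish. Otherwise `α` is approached from the right by rationals below
  -- 1.
  rcases hα.2.eq_or_lt with rfl | hα1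
  · simpa using hε.le
  have hdev : ∀ q : {q : ℚ // (q : ℝ) < 1},
      |∑ k, (chosenReward r (q : ℚ) (S k) - ∫ θ, chosenReward r (q : ℚ) θ ∂D)| ≤ s * ε := by
    intro q
    by_contra! h
    exact hS ⟨q, by simpa [f] using h⟩
  obtain ⟨u, hu, hulim⟩ : ∃ u : ℕ → ℚ, (∀ i, α < u i ∧ (u i : ℝ) < 1) ∧
      Filter.Tendsto (fun i => (u i : ℝ)) Filter.atTop (nhds α) := by
    have hx : ∀ i : ℕ, α < min 1 (α + 1 / ((i : ℝ) + 1)) := fun i =>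
      lt_min hα1 (lt_add_of_pos_right _ (by positivity))
    choose u hu1 hu2 using fun i => exists_rat_btwn (hx i)
    refine ⟨u, fun i => ⟨hu1 i, (hu2 i).trans_le (min_le_left _ _)⟩, ?_⟩
    refine tendsto_of_tendsto_of_tendsto_of_le_of_le tendsto_const_nhds ?_
      (fun i => (hu1 i).le) (fun i => (hu2 i).le.trans (min_le_right _ _))
    simpa using tendsto_const_nhds.add (tendsto_one_div_add_atTop_nhds_zero_nat (𝕜 := ℝ))
  have hur : Filter.Tendsto (fun i => (u i : ℝ)) Filter.atTop (nhdsWithin α (Set.Ioi α)) :=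
    tendsto_nhdsWithin_iff.2 ⟨hulim, Filter.Eventually.of_forall fun i => (hu i).1⟩
  have hlim : ∀ θ : AgentType n m, Filter.Tendsto (fun i => chosenReward r (u i) θ) Filter.atTop
      (nhds (chosenReward r α θ)) := fun θ =>
    tendsto_const_nhds.congr' <|
      (hur.eventually (eventually_chosenReward_eq r θ hα1)).mono fun _ h => h.symm
  have hlimint : Filter.Tendsto (fun i => ∫ θ, chosenReward r (u i) θ ∂D) Filter.atTop
      (nhds (∫ θ, chosenReward r α θ ∂D)) := by
    refine tendsto_integral_of_dominated_convergence (fun _ => 1)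
      (fun i => (measurable_chosenReward r (hu i).2).aestronglyMeasurable) (integrable_const 1)
      (fun i => Filter.Eventually.of_forall fun θ => ?_) (Filter.Eventually.of_forall hlim)
    rw [Real.norm_eq_abs, abs_of_nonneg (hf01 _ θ).1]
    exact (hf01 _ θ).2
  have hdevα : |∑ k, (chosenReward r α (S k) - ∫ θ, chosenReward r α θ ∂D)| ≤ s * ε :=
    le_of_tendsto' (tendsto_finsetSum _ fun k _ => (hlim (S k)).sub hlimint).abs
      fun i => hdev ⟨u i, (hu i).2⟩
  have heq : ∫ θ, (1 - α) * chosenReward r α θ ∂D -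
      1 / (s : ℝ) * ∑ k, (1 - α) * chosenReward r α (S k) =
      -((1 - α) * (∑ k, (chosenReward r α (S k) - ∫ θ, chosenReward r α θ ∂D)) / s) := by
    rw [integral_const_mul, ← Finset.mul_sum, Finset.sum_sub_distrib]
    simp only [Finset.sum_const, Finset.card_univ, Fintype.card_fin, nsmul_eq_mul]
    field_simp
    ring
  rw [heq, abs_neg, abs_div, abs_mul, abs_of_pos hs0, abs_of_nonneg (by linarith [hα.2]),
    div_le_iff₀ hs0, mul_comm ε]
  exact (mul_le_of_le_one_left (abs_nonneg _) (by linarith [hα.1])).trans hdevα
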